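/- Let $\mathcal H$ be a complex Hilbert space and let $G$ be a metric operator in $\mathcal H$, that is, a self-adjoint operator, bounded or not, with $\langle G\xi,\xi\rangle\ge 0$ for all $\xi\in D(G)$ and $\langle G\xi,\xi\rangle=0$ only for $\xi=0$. Put $S=G^{-1/2}$ if $G$ is bounded; $S=G^{1/2}$ if $G^{-1}$ is bounded; and $S=(I+G)^{1/2}$ or $S=(I+G^{-1})^{1/2}$ if $G$ and $G^{-1}$ are both unbounded. In each case $S$ is a positive self-adjoint operator with bounded inverse. Let $V_{\mathcal G}=\{\mathcal H_n: n\in\mathbb Z\}$ be the Hilbert scale built on the powers of $S$: for $n\ge 0$, $\mathcal H_n=D(S^n)$ with the norm $\|S^n\xi\|$, and $\mathcal H_{-n}=\mathcal H_n^\times$ is its conjugate dual, so that $\mathcal H_0=\mathcal H$ and $\mathcal H_m\subset\mathcal H_n$ for $n\le m$. Let $\langle f,g\rangle=\langle S^{-n}f,S^{n}g\rangle_{\mathcal H}$ ($f\in\mathcal H_{-n}$, $g\in\mathcal H_n$) be the partial inner product. An operator in $V_{\mathcal G}$ is a linear map $A:D(A)\to\bigcup_n\mathcal H_n$, where $D(A)=\bigcup_{r\in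 d}\mathcal H_r$ for a non-empty set $d\subset\mathbb Z$, such that for each $r\in d$ some $u\in\mathbb Z$ exists for which $A$ maps $\mathcal H_r$ continuously into $\mathcal H_u$, and such that $A$ has no proper extension with these properties. If $A$ maps $\mathcal H_r$ continuously into $\mathcal H_u$, its restriction $A_{ur}:\mathcal H_r\to\mathcal H_u$ is called a representative of $A$. The adjoint $A^\times$ is the operator in $V_{\mathcal G}$ that has, for every representative $A_{ur}$ of $A$, a representative $(A^\times)_{-r,-u}:\mathcal H_{-u}\to\mathcal H_{-r}$ with $\langle A^\times y,x\rangle=\langle y,Ax\rangle$ for $x\in\mathcal H_r$, $y\in\mathcal H_{-u}$. The operator $A$ is symmetric if $A=A^\times$. **Theorem.** Let $A=A^\times$ be a symmetric operator in $V_{\mathcal G}$. Assume that there are $\lambda\in\mathbb R$ and $m,n\in\mathbb Z$ with $\mathcal H_m\subset\mathcal H_n$ such that $A-\lambda I$ has a boundedly invertible representative $(A-\lambda I)_{nm}:\mathcal H_m\to\mathcal H_n$. Let $F=A_{nm}$ if $\mathcal H\subset\mathcal H_n$, and $F=A$ if $\mathcal H_n\subset\mathcal H$ (if both inclusions hold,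 either choice is allowed). (i) $F$ has a unique restriction to a self-adjoint operator $\mathsf A$ in the Hilbert space $\mathcal H$. Its domain is dense and equals $D(\mathsf A)=\{\xi\in\mathcal H\cap D(F): F\xi\in\mathcal H\}$. In addition, $\lambda\in\rho(\mathsf A)$. (ii) If the natural embedding $\mathcal H_m\to\mathcal H_n$ is compact, then $\mathsf A$ has a purely point spectrum of finite multiplicity: $\sigma(\mathsf A)=\sigma_p(\mathsf A)$, every eigenvalue of $\mathsf A$ has a finite-dimensional eigenspace, and $\sigma_c(\mathsf A)=\emptyset$, where $\sigma_c(\mathsf A)$ is the set of the $z\in\mathbb C$ for which $\mathsf A-zI$ is injective with dense range different from $\mathcal H$. -/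

import Mathlib

open scoped InnerProductSpace

noncomputable section

/-! ### Unbounded operators in a Hilbert space -/

namespace PipKLMN

section Unbounded

variable {H : Type*} [NormedAddCommGroup H] [InnerProductSpace ℂ H] [CompleteSpace H]

/-- A metric operator: a strictly positive self-adjoint operator, bounded or not. -/
structure IsMetricOperator (G : H →ₗ.[ℂ] H) : Prop where
  selfAdjoint : IsSelfAdjoint G
  nonneg : ∀ ξ : G.domain, 0 ≤ (⟪G ξ, (ξ : H)⟫_ℂ).re
  eq_zero_iff : ∀ ξ : G.domain, ⟪G ξ, (ξ : H)⟫_ℂ = 0 ↔ ξ = 0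

/-- Boundedness of a partially defined operator on its domain. -/
def IsBddOperator (T : H →ₗ.[ℂ] H) : Prop :=
  ∃ C : ℝ, ∀ ξ : T.domain, ‖T ξ‖ ≤ C * ‖(ξ : H)‖

/-- The operator `T - z`, defined on the domain of `T`. -/
def subScalar (T : H →ₗ.[ℂ] H) (z : ℂ) : T.domain →ₗ[ℂ] H :=
  T.toFun - z • T.domain.subtype

/-- The resolvent set: `T - z` is a bijection of the domain of `T` onto `H`, with an inverse that
is bounded on `H`. -/
def resolventSet (T : H →ₗ.[ℂ] H) : Set ℂ :=
  {z | ∃ (R : H →L[ℂ] H) (hR : ∀ y, R y ∈ T.domain),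
    (∀ y, subScalar T z ⟨R y, hR y⟩ = y) ∧ ∀ x : T.domain, R (subScalar T z x) = x}

/-- The spectrum. -/
def spectrumSet (T : H →ₗ.[ℂ] H) : Set ℂ := (resolventSet T)ᶜ

/-- The point spectrum, that is, the set of eigenvalues. -/
def pointSpectrum (T : H →ₗ.[ℂ] H) : Set ℂ :=
  {z | ¬ Function.Injective (subScalar T z)}

/-- The continuous spectrum: `T - z` is injective, and its range is dense but not all of `H`. -/
def contSpectrum (T : H →ₗ.[ℂ] H) : Set ℂ :=
  {z | Function.Injective (subScalar T z) ∧ DenseRange (subScalar T z) ∧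
    ¬ Function.Surjective (subScalar T z)}

/-- The eigenspace of `T` for `z`; its dimension is the multiplicity of `z`. -/
def eigenspace (T : H →ₗ.[ℂ] H) (z : ℂ) : Submodule ℂ T.domain :=
  LinearMap.ker (subScalar T z)

end Unbounded

/-! ### The Hilbert scale -/

/-- A bounded metric operator `B`. The scale below is built on the powers of the operator
`S = B⁻¹`, which is a metric operator with bounded inverse. -/
structure BddMetric (H : Type*) [NormedAddCommGroup H] [InnerProductSpace ℂ H]
    [CompleteSpace H] where
  op : H →L[ℂ] H
  pos : op.IsPositive
  inj : Function.Injective op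

section Generator

variable {H : Type*} [NormedAddCommGroup H] [InnerProductSpace ℂ H] [CompleteSpace H]

/-- `B = P^{-1/2}`, that is, the positive bounded operator `B` satisfies `B² = P⁻¹`. -/
def IsInvSqrt (P : H →ₗ.[ℂ] H) (B : BddMetric H) : Prop :=
  P.inverse = ((B.op ∘L B.op : H →L[ℂ] H) : H →ₗ[ℂ] H).toPMap ⊤

/-- The operator `I + P`. -/
def onePlus (P : H →ₗ.[ℂ] H) : H →ₗ.[ℂ] H :=
  (LinearMap.id : H →ₗ[ℂ] H) +ᵥ P

/-- `S = B⁻¹` is the operator on whose powers the scale attached to `G` is built: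
`S = G^{-1/2}` if `G` is bounded, `S = G^{1/2}` if `G⁻¹` is bounded, and
`S = (I + G)^{1/2}` or `S = (I + G⁻¹)^{1/2}` if `G` and `G⁻¹` are both unbounded. -/
def IsScaleGenerator (G : H →ₗ.[ℂ] H) (B : BddMetric H) : Prop :=
  (IsBddOperator G ∧ IsInvSqrt G.inverse B) ∨
  (IsBddOperator G.inverse ∧ IsInvSqrt G B) ∨
  (¬ IsBddOperator G ∧ ¬ IsBddOperator G.inverse ∧
    (IsInvSqrt (onePlus G) B ∨ IsInvSqrt (onePlus G.inverse) B))

end Generator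

namespace BddMetric

variable {H : Type*} [NormedAddCommGroup H] [InnerProductSpace ℂ H] [CompleteSpace H]
variable (B : BddMetric H)

/-- The smallest space `H_∞ = ⋂ₙ D(Sⁿ)` of the scale; note that `D(Sⁿ)` is the range of `Bⁿ`. -/
def core : Submodule ℂ H := ⨅ n : ℕ, LinearMap.range ((B.op ^ n : H →L[ℂ] H) : H →ₗ[ℂ] H)

theorem mem_core {x : H} : x ∈ B.core ↔ ∀ n : ℕ, ∃ y, (B.op ^ n) y = x := by
  rw [core, Submodule.mem_iInf]
  exact Iff.rfl

theorem op_mem_core {x : H} (hx : x ∈ B.core) : B.op x ∈ B.core := by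
  rw [mem_core] at hx ⊢
  intro n
  obtain ⟨y, rfl⟩ := hx n
  refine ⟨B.op y, ?_⟩
  rw [← mul_apply_eq_comp, ← mul_apply_eq_comp, pow_mul_comm']

/-- The operator `S⁻¹ = B`, as a bijection of `H_∞`. -/
def coreEquiv : B.core ≃ₗ[ℂ] B.core :=
  LinearEquiv.ofBijective
    ((B.op : H →ₗ[ℂ] H).restrict (p := B.core) (q := B.core) fun _ hx => B.op_mem_core hx) <| by
    constructor
    · intro x y h
      exact Subtype.ext (B.inj (congrArg Subtype.val h))
    · rintro ⟨x, hx⟩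
      obtain ⟨y, hy⟩ := B.mem_core.1 hx 1
      refine ⟨⟨y, B.mem_core.2 fun n => ?_⟩, Subtype.ext (by simpa using hy)⟩
      obtain ⟨z, hz⟩ := B.mem_core.1 hx (n + 1)
      refine ⟨z, B.inj ?_⟩
      rw [pow_succ', mul_apply_eq_comp] at hz
      rw [hz, ← hy, pow_one]

theorem dense_core : Dense (B.core : Set H) := by
  have hsa : IsSelfAdjoint B.op := B.pos.isSelfAdjoint
  -- a continuous function of `B` that vanishes near `0` maps `H` into `H_∞`
  have key : ∀ ε : ℝ, 0 < ε → ∀ x : H, ∃ y ∈ B.core, ‖B.op x - y‖ ≤ ε * ‖x‖ := by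
    intro ε hε x
    -- `f` approximates the identity and vanishes on `[-ε, ε]`
    let f : ℝ → ℝ := fun t => t - max (-ε) (min ε t)
    have hf : Continuous f := by fun_prop
    refine ⟨cfc f B.op x, B.mem_core.2 fun n => ?_, ?_⟩
    · let g : ℝ → ℝ := fun t => (t / max (t ^ 2) (ε ^ 2)) ^ n * f t
      have hpos : ∀ t : ℝ, max (t ^ 2) (ε ^ 2) ≠ 0 := fun t =>
        (lt_of_lt_of_le (by positivity) (le_max_right _ _)).ne'
      have hg : Continuous g := by
        refine Continuous.mul (Continuous.pow ?_ n) hf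
        exact continuous_id.div (by fun_prop) hpos
      have hfg : f = fun t => t ^ n * g t := by
        funext t
        by_cases ht : |t| ≤ ε
        · have : f t = 0 := by
            have h1 := abs_le.1 ht
            simp [f, min_eq_right h1.2, max_eq_right h1.1]
          simp [g, this]
        · have h1 : ε ^ 2 ≤ t ^ 2 := by
            rw [← sq_abs t]
            exact pow_le_pow_left₀ hε.le (not_le.1 ht).le 2
          have h2 : t ≠ 0 := by
            rintro rfl
            simp at ht
            linarith
          have h3 : t * (t / max (t ^ 2) (ε ^ 2)) = 1 := by
            rw [max_eq_left h1]
            field_simp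
          simp only [g]
          rw [← mul_assoc, ← mul_pow, h3, one_pow, one_mul]
      refine ⟨cfc g B.op x, ?_⟩
      rw [← mul_apply_eq_comp]
      congr 1
      rw [hfg, cfc_mul (fun t : ℝ => t ^ n) g B.op (by fun_prop) hg.continuousOn,
        cfc_pow_id B.op n]
    · have h1 : B.op - cfc f B.op = cfc (fun t : ℝ => max (-ε) (min ε t)) B.op := by
        conv_lhs => rw [← cfc_id ℝ B.op]
        rw [cfc_id ℝ B.op]
        nth_rewrite 1 [← cfc_id ℝ B.op]
        rw [← cfc_sub _ _ B.op (by fun_prop) hf.continuousOn]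
        congr 1
        funext t
        simp [f]
      have h2 : ‖B.op - cfc f B.op‖ ≤ ε := by
        rw [h1]
        refine norm_cfc_le hε.le fun t _ => ?_
        rw [Real.norm_eq_abs, abs_le]
        exact ⟨le_max_left _ _, max_le (by linarith) (min_le_left _ _)⟩
      calc ‖B.op x - cfc f B.op x‖ = ‖(B.op - cfc f B.op) x‖ := by simp
        _ ≤ ‖B.op - cfc f B.op‖ * ‖x‖ := ContinuousLinearMap.le_opNorm _ _
        _ ≤ ε * ‖x‖ := by gcongr
  have hrange : ∀ x : H, B.op x ∈ closure (B.core : Set H) := by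
    intro x
    rw [Metric.mem_closure_iff]
    intro δ hδ
    obtain ⟨y, hy, hxy⟩ := key (δ / (‖x‖ + 1)) (by positivity) x
    refine ⟨y, hy, ?_⟩
    rw [dist_eq_norm]
    refine lt_of_le_of_lt hxy ?_
    rw [div_mul_eq_mul_div, div_lt_iff₀ (by positivity)]
    nlinarith [norm_nonneg x]
  have horth : (B.core.topologicalClosure)ᗮ = ⊥ := by
    rw [Submodule.eq_bot_iff]
    intro v hv
    apply B.inj
    rw [map_zero]
    have h := (Submodule.mem_orthogonal _ _).1 hv (B.op (B.op v)) (hrange _)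
    rw [← ContinuousLinearMap.adjoint_inner_right, hsa.adjoint_eq, inner_self_eq_zero] at h
    exact h
  rw [Submodule.orthogonal_closure] at horth
  exact Submodule.dense_iff_topologicalClosure_eq_top.2
    (Submodule.topologicalClosure_eq_top_iff.2 horth)

/-- The space of all antilinear functionals on `H_∞`, in which all spaces of the scale live. -/
abbrev Ambient : Type _ := B.core →ₗ⋆[ℂ] ℂ

/-- The map `S⁻ⁿ : H → H_n` for an integer `n`: the vector `S⁻ⁿ η` is the functional
`φ ↦ ⟪S⁻ⁿ φ, η⟫` on `H_∞`. For `n = 0` this is the embedding of `H`; for `n ≥ 0` it is the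
embedding of the vector `Bⁿ η` of `D(Sⁿ)`; for `n = -k < 0` it is, by the Riesz theorem, the
general form of a bounded antilinear functional on `H_k`. -/
def unitary (n : ℤ) : H →ₗ[ℂ] B.Ambient where
  toFun η :=
    { toFun := fun φ => ⟪(((B.coreEquiv ^ n) φ : B.core) : H), η⟫_ℂ
      map_add' := fun φ ψ => by simp
      map_smul' := fun c φ => by simp [mul_comm] }
  map_add' η ζ := by ext φ; simp
  map_smul' c η := by ext φ; simp

theorem unitary_apply (n : ℤ) (η : H) (φ : B.core) :
    B.unitary n η φ = ⟪(((B.coreEquiv ^ n) φ : B.core) : H), η⟫_ℂ := rfl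

theorem unitary_injective (n : ℤ) : Function.Injective (B.unitary n) := by
  rw [injective_iff_map_eq_zero]
  intro η h
  refine B.dense_core.eq_zero_of_inner_right (𝕜 := ℂ) fun v hv => ?_
  have h1 := LinearMap.congr_fun h ((B.coreEquiv ^ n).symm ⟨v, hv⟩)
  rw [unitary_apply, LinearEquiv.apply_symm_apply] at h1
  exact h1

/-- The space `H_n = S⁻ⁿ H` of the scale, `n ∈ ℤ`. -/
def space (n : ℤ) : Submodule ℂ B.Ambient := LinearMap.range (B.unitary n)

/-- The operator `Sⁿ : H_n → H`. -/
def coord (n : ℤ) : B.space n ≃ₗ[ℂ] H :=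
  (LinearEquiv.ofInjective (B.unitary n) (B.unitary_injective n)).symm

/-- The norm `‖f‖_n = ‖Sⁿ f‖` of `H_n`. -/
instance instNormedAddCommGroupSpace (n : ℤ) : NormedAddCommGroup (B.space n) :=
  NormedAddCommGroup.induced (B.space n) H (B.coord n) (B.coord n).injective

theorem norm_space (n : ℤ) (f : B.space n) : ‖f‖ = ‖B.coord n f‖ := rfl

instance instInnerProductSpaceSpace (n : ℤ) : InnerProductSpace ℂ (B.space n) where
  inner f g := ⟪B.coord n f, B.coord n g⟫_ℂ
  norm_smul_le c f := by simp [norm_space, norm_smul]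
  norm_sq_eq_re_inner f := by
    rw [norm_space]
    exact norm_sq_eq_re_inner (B.coord n f)
  conj_inner_symm f g := inner_conj_symm _ _
  add_left f g h := by simp
  smul_left f g c := by simp [mul_comm]

/-- The partial inner product `⟪f, g⟫ = ⟪S⁻ⁿ f, Sⁿ g⟫` of `f ∈ H_{-n}` and `g ∈ H_n`. -/
def pip (n : ℤ) (f : B.space (-n)) (g : B.space n) : ℂ := ⟪B.coord (-n) f, B.coord n g⟫_ℂ

/-- The embedding of the central Hilbert space `H` in the scale; its range is `H_0`. -/
def central : H →ₗ[ℂ] B.Ambient := B.unitary 0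

/-! ### Operators in the scale -/

/-- `T` is the representative `A_{ur} : H_r → H_u` of `A`. -/
def IsRep (A : B.Ambient →ₗ.[ℂ] B.Ambient) (r u : ℤ) (T : B.space r →L[ℂ] B.space u) : Prop :=
  ∀ x : B.space r, ∃ h : (x : B.Ambient) ∈ A.domain, A ⟨x, h⟩ = (T x : B.Ambient)

/-- The domain of `A` is the union of the spaces `H_r`, `r ∈ d`, where `d` is a non-empty set of
integers, and `A` maps each of these spaces continuously into some `H_u`. -/
def IsPreOp (A : B.Ambient →ₗ.[ℂ] B.Ambient) : Prop :=
  ∃ d : Set ℤ, d.Nonempty ∧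
    (A.domain : Set B.Ambient) = ⋃ r ∈ d, (B.space r : Set B.Ambient) ∧
    ∀ r ∈ d, ∃ (u : ℤ) (T : B.space r →L[ℂ] B.space u), B.IsRep A r u T

/-- `A` belongs to `Op(V)`, where `V` is the scale: it satisfies the preceding conditions, and has
no proper extension that satisfies them. -/
def IsOp (A : B.Ambient →ₗ.[ℂ] B.Ambient) : Prop :=
  B.IsPreOp A ∧ ∀ A', B.IsPreOp A' → A ≤ A' → A' = A

/-- `A'` is the adjoint `A^×` of `A`: whenever `A` has a representative `A_{ur}`, `A'` has a
representative `A'_{-r,-u}`, and `⟪A' y, x⟫ = ⟪y, A x⟫` for `x ∈ H_r` and `y ∈ H_{-u}`. -/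
def IsAdjoint (A A' : B.Ambient →ₗ.[ℂ] B.Ambient) : Prop :=
  B.IsOp A ∧ B.IsOp A' ∧
    ∀ (r u : ℤ) (T : B.space r →L[ℂ] B.space u), B.IsRep A r u T →
      ∃ T' : B.space (-u) →L[ℂ] B.space (-r), B.IsRep A' (-u) (-r) T' ∧
        ∀ (x : B.space r) (y : B.space (-u)), B.pip r (T' y) x = B.pip u y (T x)

/-- `A` is a symmetric operator in the scale, `A = A^×`. -/
def IsSymmetricOp (A : B.Ambient →ₗ.[ℂ] B.Ambient) : Prop := B.IsAdjoint A A

/-- `T - z : H_r → H_u` is boundedly invertible, where `H_r ⊆ H_u`. -/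
def IsBddInvertible {r u : ℤ} (T : B.space r →L[ℂ] B.space u) (z : ℂ)
    (h : B.space r ≤ B.space u) : Prop :=
  ∃ R : B.space u →L[ℂ] B.space r,
    (∀ x, R (T x - z • Submodule.inclusion h x) = x) ∧
    (∀ y, T (R y) - z • Submodule.inclusion h (R y) = y)

/-- The operator `a` in `H` is a restriction of `F`. -/
def IsRestriction (a : H →ₗ.[ℂ] H) (F : B.Ambient →ₗ.[ℂ] B.Ambient) : Prop :=
  ∀ ξ : a.domain, ∃ h : B.central ξ ∈ F.domain, F ⟨B.central ξ, h⟩ = B.central (a ξ)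

/-- The set `{ξ ∈ H : F ξ ∈ H}`. -/
def domainInH (F : B.Ambient →ₗ.[ℂ] B.Ambient) : Set H :=
  {ξ | ∃ h : B.central ξ ∈ F.domain, F ⟨B.central ξ, h⟩ ∈ B.space 0}

end BddMetric

end PipKLMN

end

/-! Let `R : H_n → H_m` invert `(A - lam)_{nm}`. Because `A = A^×` and `lam` is real, the dual `R' :
H_{-m} → H_{-n}` inverts another representative of `A - lam`. The spaces form a chain, so two such
inverses agree wherever both are defined (`IsResolvent.consistent`). Hence on a suitable `H_k`
inside `H` they give one operator, bounded in the norm of `H_k` and symmetric for the inner product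
of `H`. A symmetrizable operator is bounded in the weaker norm (`norm_le_of_symmetrizable`), so it
extends to a bounded self-adjoint `M` on `H`. `M` is injective where `H` lies in the domain of the
inverse that induces it; then `M⁻¹ + lam` is self-adjoint and is the maximal restriction of `F` to
`H`, and any other self-adjoint restriction lies below it, hence equals it.

For (ii), a compact embedding makes some power of `B` compact unless `H` is finite-dimensional.
Cutting `M` off near the zero spectrum of `B` leaves a remainder of small norm, again by
symmetrizability, so `M` is a limit of compact operators. The Fredholm alternative for `M` then
describes the spectrum. -/

open scoped InnerProductSpace

noncomputable section

namespace PipKLMN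

/-! ### Symmetrizable operators and self-adjoint inverses. -/

section Abstract

variable {H : Type*} [NormedAddCommGroup H] [InnerProductSpace ℂ H]

/-- An operator on a normed space `K` that is symmetric for a weaker inner product is bounded for
the norm of that inner product, with at most the same bound. -/
theorem norm_le_of_symmetrizable {K : Type*} [NormedAddCommGroup K] [NormedSpace ℂ K]
    (j : K →L[ℂ] H) (L : K →L[ℂ] K) (hL : ∀ x y, ⟪j (L x), j y⟫_ℂ = ⟪j x, j (L y)⟫_ℂ) (x : K) :
    ‖j (L x)‖ ≤ ‖L‖ * ‖j x‖ := by
  -- Symmetry and Cauchy–Schwarz: the sequence `‖j (Lⁿ x)‖` is log-convex.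
  have hconv : ∀ y, ‖j (L y)‖ ^ 2 ≤ ‖j y‖ * ‖j (L (L y))‖ := by
    intro y
    have h : ‖j (L y)‖ ^ 2 = ‖⟪j y, j (L (L y))⟫_ℂ‖ := by
      rw [← hL, inner_self_eq_norm_sq_to_K]
      simp
    rw [h]
    exact norm_inner_le_norm _ _
  rcases eq_or_lt_of_le (norm_nonneg (j x)) with h0 | h0
  · have := hconv x
    rw [← h0] at this ⊢
    nlinarith [norm_nonneg (j (L x))]
  -- By log-convexity a first ratio `ρ > ‖L‖` forces growth at least like `ρⁿ`, whereas continuity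
  -- of `j` and `L` allows at most `‖L‖ⁿ`, up to constants.
  by_contra! hlt
  set ρ := ‖j (L x)‖ / ‖j x‖ with hρ
  have hLρ : ‖L‖ < ρ := (lt_div_iff₀ h0).2 hlt
  have hρ0 : 0 < ρ := (norm_nonneg L).trans_lt hLρ
  have key : ∀ n : ℕ, ρ ^ n * ‖j x‖ ≤ ‖j ((L ^ n) x)‖ ∧
      ρ * ‖j ((L ^ n) x)‖ ≤ ‖j (L ((L ^ n) x))‖ := by
    intro n
    induction n with
    | zero => simp [hρ, div_mul_cancel₀ _ h0.ne']
    | succ n ih =>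
      have e : (L ^ (n + 1)) x = L ((L ^ n) x) := by rw [pow_succ']; rfl
      rw [e]
      have hpos : 0 < ‖j ((L ^ n) x)‖ := lt_of_lt_of_le (by positivity) ih.1
      refine ⟨?_, ?_⟩
      · calc ρ ^ (n + 1) * ‖j x‖ = ρ * (ρ ^ n * ‖j x‖) := by ring
          _ ≤ ρ * ‖j ((L ^ n) x)‖ := by gcongr; exact ih.1
          _ ≤ _ := ih.2
      · have h1 := hconv ((L ^ n) x)
        refine le_of_mul_le_mul_left ?_ hpos
        nlinarith [mul_le_mul_of_nonneg_left ih.2 (norm_nonneg (j (L ((L ^ n) x))))]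
  have bound : ∀ n : ℕ, ρ ^ n * ‖j x‖ ≤ ‖j‖ * ‖x‖ * ‖L‖ ^ n := by
    intro n
    calc ρ ^ n * ‖j x‖ ≤ ‖j ((L ^ n) x)‖ := (key n).1
      _ ≤ ‖j‖ * (‖L ^ n‖ * ‖x‖) := j.le_opNorm_of_le ((L ^ n).le_opNorm x)
      _ ≤ ‖j‖ * (‖L‖ ^ n * ‖x‖) := by
        rcases n with _ | n
        · gcongr
          simpa using! ContinuousLinearMap.norm_id_le (𝕜 := ℂ) (E := K)
        · gcongr
          exact norm_pow_le' L n.succ_pos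
      _ = _ := by ring
  have hlim : Filter.Tendsto (fun n : ℕ => ‖j‖ * ‖x‖ * (‖L‖ / ρ) ^ n) Filter.atTop (nhds 0) := by
    simpa using (tendsto_pow_atTop_nhds_zero_of_lt_one (by positivity)
      ((div_lt_one hρ0).2 hLρ)).const_mul (‖j‖ * ‖x‖)
  refine absurd (ge_of_tendsto' hlim (b := ‖j x‖) fun n => ?_) (not_le.2 h0)
  rw [div_pow, ← mul_div_assoc, le_div_iff₀ (by positivity), mul_comm]
  exact bound n

theorem subScalar_apply (T : H →ₗ.[ℂ] H) (z : ℂ) (x : T.domain) :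
    subScalar T z x = T x - z • (x : H) := rfl

theorem opNorm_le_of_symmetrizable {K : Type*} [NormedAddCommGroup K] [NormedSpace ℂ K]
    (j : K →L[ℂ] H) (hj : DenseRange j) (L : K →L[ℂ] K) (M : H →L[ℂ] H)
    (hM : ∀ x, M (j x) = j (L x)) (hsymm : ∀ x y, ⟪M x, y⟫_ℂ = ⟪x, M y⟫_ℂ) : ‖M‖ ≤ ‖L‖ := by
  refine M.opNorm_le_bound (norm_nonneg _) fun x => ?_
  refine hj.induction_on (p := fun x => ‖M x‖ ≤ ‖L‖ * ‖x‖) x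
    (isClosed_le (by fun_prop) (by fun_prop)) fun y => ?_
  rw [hM]
  exact norm_le_of_symmetrizable j L (fun x y => by rw [← hM, ← hM, hsymm]) y

variable [CompleteSpace H]

/-- A symmetrizable operator extends to a bounded self-adjoint operator. -/
theorem exists_symmetric_extension {K : Type*} [NormedAddCommGroup K] [NormedSpace ℂ K]
    (j : K →L[ℂ] H) (hj : DenseRange j) (L : K →L[ℂ] K)
    (hL : ∀ x y, ⟪j (L x), j y⟫_ℂ = ⟪j x, j (L y)⟫_ℂ) :
    ∃ M : H →L[ℂ] H, (∀ x, M (j x) = j (L x)) ∧ ∀ x y, ⟪M x, y⟫_ℂ = ⟪x, M y⟫_ℂ := by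
  have hb : ∀ x, ‖((j ∘L L : K →L[ℂ] H) : K →ₗ[ℂ] H) x‖ ≤ ‖L‖ * ‖(j : K →ₗ[ℂ] H) x‖ :=
    norm_le_of_symmetrizable j L hL
  let M := ((j ∘L L : K →L[ℂ] H) : K →ₗ[ℂ] H).extendOfNorm (j : K →ₗ[ℂ] H)
  have hM : ∀ x, M (j x) = j (L x) := LinearMap.extendOfNorm_eq hj ⟨_, hb⟩
  refine ⟨M, hM, fun x y => ?_⟩
  refine hj.induction_on₂ (p := fun x y => ⟪M x, y⟫_ℂ = ⟪x, M y⟫_ℂ)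
    (isClosed_eq (by fun_prop) (by fun_prop)) (fun x y => ?_) x y
  rw [hM, hM, hL]

/-- The orthogonal complement of the range is the kernel of the adjoint, which is `M` itself. -/
theorem denseRange_of_symmetric (M : H →L[ℂ] H) (hsymm : ∀ x y, ⟪M x, y⟫_ℂ = ⟪x, M y⟫_ℂ)
    (hinj : Function.Injective M) : DenseRange M := by
  change Dense ((LinearMap.range (M : H →ₗ[ℂ] H) : Submodule ℂ H) : Set H)
  rw [Submodule.dense_iff_topologicalClosure_eq_top, Submodule.topologicalClosure_eq_top_iff,
    Submodule.eq_bot_iff]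
  intro v hv
  apply hinj
  rw [map_zero]
  refine ext_inner_left ℂ fun w => ?_
  rw [← hsymm, inner_zero_right]
  exact (Submodule.mem_orthogonal _ _).1 hv _ ⟨w, rfl⟩

/-- If `M` is bounded, self-adjoint and injective, then `M⁻¹ + lam` is self-adjoint. -/
theorem exists_selfAdjoint_of_resolvent (M : H →L[ℂ] H) (hsymm : ∀ x y, ⟪M x, y⟫_ℂ = ⟪x, M y⟫_ℂ)
    (hinj : Function.Injective M) (lam : ℝ) :
    ∃ a : H →ₗ.[ℂ] H, IsSelfAdjoint a ∧ (∀ x, x ∈ a.domain ↔ ∃ y, M y = x) ∧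
      ∀ (x : a.domain) (y : H), M y = x → a x = y + (lam : ℂ) • (x : H) := by
  let e := LinearEquiv.ofInjective (M : H →ₗ[ℂ] H) hinj
  let a : H →ₗ.[ℂ] H := ⟨LinearMap.range (M : H →ₗ[ℂ] H),
    e.symm.toLinearMap + (lam : ℂ) • (LinearMap.range (M : H →ₗ[ℂ] H)).subtype⟩
  have hdom : ∀ x, x ∈ a.domain ↔ ∃ y, M y = x := fun x => Iff.rfl
  have hval : ∀ (x : a.domain) (y : H), M y = x → a x = y + (lam : ℂ) • (x : H) := by
    intro x y h
    have h1 : e.symm x = y := by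
      rw [LinearEquiv.symm_apply_eq]
      exact Subtype.ext h.symm
    change e.symm x + (lam : ℂ) • (x : H) = _
    rw [h1]
  have hdense : Dense (a.domain : Set H) := denseRange_of_symmetric M hsymm hinj
  have hform : a.IsFormalAdjoint a := by
    intro x y
    obtain ⟨u, hu⟩ := (hdom _).1 x.2
    obtain ⟨v, hv⟩ := (hdom _).1 y.2
    rw [hval x u hu, hval y v hv, ← hu, ← hv]
    simp only [inner_add_left, inner_smul_left, Complex.conj_ofReal, hsymm, map_add, map_smul,
      inner_add_right, inner_smul_right]
  refine ⟨a, ?_, hdom, hval⟩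
  rw [LinearPMap.isSelfAdjoint_def]
  symm
  refine LinearPMap.eq_of_le_of_domain_eq (hform.le_adjoint hdense) (le_antisymm
    (hform.le_adjoint hdense).1 fun y hy => ?_)
  let w := (a.adjoint ⟨y, hy⟩ : H)
  have hw : ∀ x : a.domain, ⟪w, (x : H)⟫_ℂ = ⟪y, a x⟫_ℂ :=
    fun x => LinearPMap.adjoint_isFormalAdjoint hdense ⟨y, hy⟩ x
  -- With `w = a* y`, the preimage of `y` under `M` must be `(a* - lam) y`; testing the adjoint
  -- relation on vectors `M h` confirms it.
  refine (hdom y).2 ⟨w - (lam : ℂ) • y, ext_inner_right ℂ fun h => ?_⟩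
  have h1 := hw ⟨M h, (hdom _).2 ⟨h, rfl⟩⟩
  rw [hval _ h rfl, inner_add_right, inner_smul_right] at h1
  rw [hsymm, inner_sub_left, inner_smul_left, Complex.conj_ofReal]
  exact sub_eq_of_eq_add h1

/-- Adjoints reverse inclusions: `b ≤ a` gives `a = a* ≤ b* = b`. -/
theorem eq_of_le_of_isSelfAdjoint {a b : H →ₗ.[ℂ] H} (ha : IsSelfAdjoint a) (hb : IsSelfAdjoint b)
    (h : b ≤ a) : b = a := by
  refine le_antisymm h ?_
  have hform : b.IsFormalAdjoint a := by
    intro x y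
    have h1 := LinearPMap.adjoint_isFormalAdjoint ha.dense_domain
    rw [LinearPMap.isSelfAdjoint_def.1 ha] at h1
    rw [h.2 (x := x) (y := ⟨x, h.1 x.2⟩) rfl]
    exact h1 ⟨x, h.1 x.2⟩ y
  have := hform.le_adjoint hb.dense_domain
  rwa [LinearPMap.isSelfAdjoint_def.1 hb] at this

/-! ### The spectrum of an operator with compact resolvent. -/

section Resolvent

omit [CompleteSpace H]

variable {M : H →L[ℂ] H} {lam : ℂ} {a : H →ₗ.[ℂ] H}
  (hdom : ∀ x, x ∈ a.domain ↔ ∃ y, M y = x)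
  (hval : ∀ (x : a.domain) (y : H), M y = x → a x = y + lam • (x : H))

include hdom hval

theorem mem_resolventSet_of_range : lam ∈ resolventSet a := by
  refine ⟨M, fun y => (hdom _).2 ⟨y, rfl⟩, fun y => ?_, fun x => ?_⟩
  · rw [subScalar_apply, hval _ y rfl, add_sub_cancel_right]
  · obtain ⟨y, hy⟩ := (hdom _).1 x.2
    rw [subScalar_apply, hval _ y hy, add_sub_cancel_right, hy]

/-- As `M = (a - lam)⁻¹`, this relates `z` in the spectrum of `a` to `(z - lam)⁻¹` in that of `M`.
-/
theorem apply_subScalar (z : ℂ) (x : a.domain) :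
    M (subScalar a z x) = (x : H) - (z - lam) • M x := by
  obtain ⟨y, hy⟩ := (hdom _).1 x.2
  rw [subScalar_apply, hval _ y hy, ← hy]
  simp only [map_sub, map_add, map_smul]
  module

theorem subScalar_injective_self : Function.Injective (subScalar a lam) := by
  refine (injective_iff_map_eq_zero _).2 fun x hx => Subtype.ext ?_
  have h := apply_subScalar hdom hval lam x
  rw [hx] at h
  simpa using h.symm

variable [CompleteSpace H]

theorem finiteDimensional_eigenspace_of_isCompactOperator (hM : IsCompactOperator M) (z : ℂ) :
    FiniteDimensional ℂ (eigenspace a z) := by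
  by_cases hz : z = lam
  · subst hz
    rw [eigenspace, LinearMap.ker_eq_bot.2 (subScalar_injective_self hdom hval)]
    infer_instance
  have hz' : z - lam ≠ 0 := sub_ne_zero.2 hz
  have := ContinuousLinearMap.finite_dimensional_eigenspace hM (z - lam)⁻¹ (inv_ne_zero hz')
  let f : eigenspace a z →ₗ[ℂ] Module.End.eigenspace (M : H →ₗ[ℂ] H) (z - lam)⁻¹ :=
    (a.domain.subtype ∘ₗ (eigenspace a z).subtype).codRestrict _ fun x => by
      rw [Module.End.mem_eigenspace_iff]
      have h := apply_subScalar hdom hval z x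
      have h2 : subScalar a z x = 0 := x.2
      rw [h2, map_zero] at h
      have h3 : (x : H) = (z - lam) • M x := sub_eq_zero.1 h.symm
      change M (x : H) = (z - lam)⁻¹ • (x : H)
      conv_rhs => rw [h3]
      rw [inv_smul_smul₀ hz']
  refine FiniteDimensional.of_injective f fun x y h => ?_
  have h' := congrArg Subtype.val h
  exact Subtype.ext (Subtype.ext h')

/-- Fredholm alternative for `M` at `(z - lam)⁻¹`: an eigenvector of `M` would be one of `a` for
`z`; otherwise the resolvent of `a` at `z` is `M (1 - (z - lam) M)⁻¹`. -/
theorem mem_resolventSet_of_isCompactOperator (hM : IsCompactOperator M) {z : ℂ}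
    (hz : z ∉ pointSpectrum a) : z ∈ resolventSet a := by
  by_cases hzl : z = lam
  · subst hzl
    exact mem_resolventSet_of_range hdom hval
  have hz' : z - lam ≠ 0 := sub_ne_zero.2 hzl
  have hinj : Function.Injective (subScalar a z) := not_not.1 hz
  rcases IsCompactOperator.hasEigenvalue_or_mem_resolventSet hM (inv_ne_zero hz') with h | h
  · obtain ⟨v, hv⟩ := h.exists_hasEigenvector
    have hv1 : M v = (z - lam)⁻¹ • v := hv.apply_eq_smul
    have hv2 : M ((z - lam) • v) = v := by rw [map_smul, hv1, smul_inv_smul₀ hz']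
    have hmem : v ∈ a.domain := (hdom v).2 ⟨_, hv2⟩
    have h0 : subScalar a z ⟨v, hmem⟩ = 0 := by
      rw [subScalar_apply, hval _ _ hv2]
      module
    have := hinj (h0.trans (map_zero (subScalar a z)).symm)
    exact absurd (congrArg Subtype.val this) hv.2
  · rw [spectrum.mem_resolventSet_iff] at h
    obtain ⟨u, hu⟩ := h
    -- `u = (z - lam)⁻¹ - M`, so the rescaling makes `N` the inverse of `1 - (z - lam) M`.
    let N : H →L[ℂ] H := (z - lam)⁻¹ • (↑u⁻¹ : H →L[ℂ] H)
    have hu' : ∀ x, (u : H →L[ℂ] H) x = (z - lam)⁻¹ • x - M x := by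
      intro x
      rw [hu]
      simp [Algebra.algebraMap_eq_smul_one]
    have h1 : ∀ x, N (x - (z - lam) • M x) = x := by
      intro x
      have e : x - (z - lam) • M x = (z - lam) • (u : H →L[ℂ] H) x := by
        rw [hu', smul_sub, smul_inv_smul₀ hz']
      have e2 : (↑u⁻¹ : H →L[ℂ] H) ((u : H →L[ℂ] H) x) = x := by
        rw [← mul_apply_eq_comp, Units.inv_mul]
        rfl
      rw [e, map_smul]
      change (z - lam) • (z - lam)⁻¹ • (↑u⁻¹ : H →L[ℂ] H) ((u : H →L[ℂ] H) x) = x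
      rw [e2, smul_inv_smul₀ hz']
    have h2 : ∀ y, N y - (z - lam) • M (N y) = y := by
      intro y
      have e2 : (u : H →L[ℂ] H) ((↑u⁻¹ : H →L[ℂ] H) y) = y := by
        rw [← mul_apply_eq_comp, Units.mul_inv]
        rfl
      have e3 : (z - lam) • (u : H →L[ℂ] H) (N y) = y := by
        change (z - lam) • (u : H →L[ℂ] H) ((z - lam)⁻¹ • (↑u⁻¹ : H →L[ℂ] H) y) = y
        rw [map_smul, e2, smul_inv_smul₀ hz']
      rw [hu', smul_sub, smul_inv_smul₀ hz'] at e3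
      exact e3
    have hcomm : ∀ y, N (M y) = M (N y) := by
      intro y
      conv_lhs => rw [← h2 y]
      rw [map_sub, map_smul, h1]
    refine ⟨M ∘L N, fun y => (hdom _).2 ⟨_, rfl⟩, fun y => ?_, fun x => ?_⟩
    · rw [subScalar_apply, hval _ (N y) rfl]
      refine Eq.trans ?_ (h2 y)
      change N y + lam • M (N y) - z • M (N y) = _
      module
    · change M (N _) = _
      rw [← hcomm, apply_subScalar hdom hval, h1]

theorem spectrum_of_isCompactOperator (hM : IsCompactOperator M) :
    spectrumSet a = pointSpectrum a ∧
      (∀ z ∈ pointSpectrum a, FiniteDimensional ℂ (eigenspace a z)) ∧ contSpectrum a = ∅ := by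
  have hres : ∀ z ∈ resolventSet a,
      Function.Injective (subScalar a z) ∧ Function.Surjective (subScalar a z) := by
    rintro z ⟨R, hR, h1, h2⟩
    refine ⟨fun x y h => Subtype.ext ?_, fun y => ⟨_, h1 y⟩⟩
    rw [← h2 x, ← h2 y, h]
  refine ⟨Set.ext fun z => ⟨fun h => ?_, fun h hz => h (hres z hz).1⟩,
    fun z _ => finiteDimensional_eigenspace_of_isCompactOperator hdom hval hM z,
    Set.eq_empty_of_forall_notMem fun z hz => ?_⟩
  · by_contra hz
    exact h (mem_resolventSet_of_isCompactOperator hdom hval hM hz)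
  · exact hz.2.2 (hres z (mem_resolventSet_of_isCompactOperator hdom hval hM (not_not.2 hz.1))).2

end Resolvent

end Abstract

end PipKLMN

namespace PipKLMN

/-! ### Spectral cutoffs and compactness. -/

section Cutoff

variable {H : Type*} [NormedAddCommGroup H] [InnerProductSpace ℂ H] [CompleteSpace H]

theorem pow_symmetric {B : H →L[ℂ] H} (hB : IsSelfAdjoint B) (k : ℕ) (x y : H) :
    ⟪(B ^ k) x, y⟫_ℂ = ⟪x, (B ^ k) y⟫_ℂ :=
  (ContinuousLinearMap.isSelfAdjoint_iff_isSymmetric.1 (hB.pow k)) x y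

omit [CompleteSpace H] in
theorem pow_injective {B : H →L[ℂ] H} (hB : Function.Injective B) (k : ℕ) :
    Function.Injective (B ^ k : H →L[ℂ] H) := by
  induction k with
  | zero => exact fun x y h => h
  | succ k ih =>
    intro x y h
    rw [pow_succ'] at h
    exact ih (hB h)

/-- A self-adjoint operator `B` is small after multiplication by a cutoff `E` near `0`, and `1 - E`
is a multiple of `Bᵈ`. -/
theorem exists_cutoff {B : H →L[ℂ] H} (hB : IsSelfAdjoint B) {d : ℕ} (hd : 1 ≤ d) {ε : ℝ}
    (hε : 0 < ε) : ∃ E W : H →L[ℂ] H, IsSelfAdjoint E ∧ Commute E B ∧ ‖E‖ ≤ 1 ∧ ‖E * B‖ ≤ ε ∧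
      1 - E = W * B ^ d := by
  -- `E = f(B)` and `W = g(B)`, with `1 - f t = g t * t ^ d`. The bound `|f t * t| ≤ ε` uses `|f| ≤
  -- 1` for `|t| ≤ ε`, and `ε ^ (2d) * |t| ≤ ε * t ^ (2d)` for `|t| ≥ ε`.
  let f : ℝ → ℝ := fun t => ε ^ (2 * d) / (t ^ (2 * d) + ε ^ (2 * d))
  let g : ℝ → ℝ := fun t => t ^ d / (t ^ (2 * d) + ε ^ (2 * d))
  have hpos : ∀ t : ℝ, 0 < t ^ (2 * d) + ε ^ (2 * d) := fun t => by
    have : 0 ≤ t ^ (2 * d) := (even_two_mul d).pow_nonneg t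
    positivity
  have hf : Continuous f := continuous_const.div (by fun_prop) fun t => (hpos t).ne'
  have hg : Continuous g := (continuous_pow d).div (by fun_prop) fun t => (hpos t).ne'
  have habs : ∀ t, |f t| ≤ 1 := fun t => by
    have : 0 ≤ t ^ (2 * d) := (even_two_mul d).pow_nonneg t
    rw [abs_of_nonneg (div_nonneg (by positivity) (hpos t).le), div_le_one (hpos t)]
    linarith
  refine ⟨cfc f B, cfc g B, cfc_predicate f B, hB.commute_cfc (Commute.refl B) f,
    norm_cfc_le zero_le_one fun t _ => habs t, ?_, ?_⟩
  · nth_rewrite 2 [← cfc_id ℝ B hB]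
    rw [← cfc_mul f id B hf.continuousOn continuousOn_id]
    refine norm_cfc_le hε.le fun t _ => ?_
    rw [Real.norm_eq_abs, abs_mul, id]
    rcases le_total |t| ε with h | h
    · nlinarith [habs t, abs_nonneg t, abs_nonneg (f t)]
    · have h1 : ε ^ (2 * d - 1) ≤ |t| ^ (2 * d - 1) := pow_le_pow_left₀ hε.le h _
      have e : 2 * d = (2 * d - 1) + 1 := by omega
      have h2 : t ^ (2 * d) = |t| ^ (2 * d - 1) * |t| := by
        rw [← pow_succ, ← e, (even_two_mul d).pow_abs]
      have h3 : ε ^ (2 * d) = ε ^ (2 * d - 1) * ε := by rw [← pow_succ, ← e]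
      rw [abs_of_nonneg (div_nonneg (by positivity) (hpos t).le), div_mul_eq_mul_div,
        div_le_iff₀ (hpos t), h3, h2]
      have h4 : 0 ≤ ε * ε ^ (2 * d - 1) * ε := by positivity
      nlinarith [mul_le_mul_of_nonneg_left h1 (mul_nonneg hε.le (abs_nonneg t))]
  · rw [← cfc_pow_id (R := ℝ) B d, ← cfc_mul g _ B hg.continuousOn (by fun_prop),
      ← cfc_const_one ℝ B, ← cfc_sub _ f B (by fun_prop) hf.continuousOn]
    congr 1
    funext t
    have := (hpos t).ne'
    simp only [f, g]
    field_simp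
    ring

/-- Compactness of a self-adjoint operator that intertwines with a factorized operator. -/
theorem isCompactOperator_of_intertwining {B : H →L[ℂ] H} (hB : IsSelfAdjoint B)
    (hinj : Function.Injective B) {d : ℕ} (hd : 1 ≤ d) (hcpt : IsCompactOperator (B ^ d : H →L[ℂ] H))
    (M X : H →L[ℂ] H) (hM : ∀ x y, ⟪M x, y⟫_ℂ = ⟪x, M y⟫_ℂ) {k α β : ℕ} (hαβ : 1 ≤ α + β)
    (hMX : ∀ y, M ((B ^ k) y) = (B ^ k) ((B ^ α) (X ((B ^ β) y)))) : IsCompactOperator M := by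
  -- Since `α + β ≥ 1`, one factor `B` can be split off on the left or the right and absorbed by the
  -- adjacent `E`; `C` is the norm of what remains, independent of `E`.
  obtain ⟨C, hC0, hC⟩ : ∃ C : ℝ, 0 ≤ C ∧ ∀ (E : H →L[ℂ] H) (ε : ℝ), Commute E B → ‖E‖ ≤ 1 → 0 < ε →
      ‖E * B‖ ≤ ε → ‖E * (B ^ α * X * B ^ β) * E‖ ≤ C * ε := by
    rcases Nat.eq_zero_or_pos α with h | h
    · obtain ⟨b, rfl⟩ : ∃ b, β = b + 1 := ⟨β - 1, by omega⟩
      refine ⟨‖B ^ α * X * B ^ b‖, norm_nonneg _, fun E ε hc h1 hε h2 => ?_⟩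
      have e : E * (B ^ α * X * B ^ (b + 1)) * E = E * (B ^ α * X * B ^ b) * (E * B) := by
        rw [hc.eq, pow_succ]
        simp only [mul_assoc]
      rw [e]
      calc _ ≤ ‖E‖ * ‖B ^ α * X * B ^ b‖ * ‖E * B‖ :=
            (norm_mul_le _ _).trans (mul_le_mul_of_nonneg_right (norm_mul_le _ _) (norm_nonneg _))
        _ ≤ 1 * ‖B ^ α * X * B ^ b‖ * ε := by gcongr
        _ = _ := by ring
    · obtain ⟨b, rfl⟩ : ∃ b, α = b + 1 := ⟨α - 1, by omega⟩
      refine ⟨‖B ^ b * X * B ^ β‖, norm_nonneg _, fun E ε hc h1 hε h2 => ?_⟩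
      have e : E * (B ^ (b + 1) * X * B ^ β) * E = (E * B) * (B ^ b * X * B ^ β) * E := by
        rw [pow_succ']
        simp only [mul_assoc]
      rw [e]
      calc _ ≤ ‖E * B‖ * ‖B ^ b * X * B ^ β‖ * ‖E‖ :=
            (norm_mul_le _ _).trans (mul_le_mul_of_nonneg_right (norm_mul_le _ _) (norm_nonneg _))
        _ ≤ ε * ‖B ^ b * X * B ^ β‖ * 1 := by gcongr
        _ = _ := by ring
  have hclosed := isClosed_setOfPred_isCompactOperator (𝕜₁ := ℂ) (𝕜₂ := ℂ) (σ₁₂ := RingHom.id ℂ)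
    (M₁ := H) (M₂ := H)
  refine hclosed.closure_subset (Metric.mem_closure_iff.2 fun δ hδ => ?_)
  have hε : 0 < δ / (C + 1) := by positivity
  obtain ⟨E, W, hE, hc, h1, h2, h3⟩ := exists_cutoff hB hd hε
  have hQ : IsCompactOperator (1 - E : H →L[ℂ] H) := by
    rw [h3]
    exact hcpt.clm_comp W
  -- Each term of the difference contains the factor `1 - E`, compact through `Bᵈ`. The error `E M
  -- E` is symmetric and is intertwined by `Bᵏ` with the small operator of `hC`, so it inherits the
  -- bound.
  refine ⟨M - E * M * E, ?_, ?_⟩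
  · have e : M - E * M * E = (1 - E) * M + (E * M) * (1 - E) := by noncomm_ring
    rw [e]
    exact (hQ.comp_clm M).add (hQ.clm_comp (E * M))
  · rw [dist_eq_norm, sub_sub_cancel]
    have hEs : ∀ x y, ⟪E x, y⟫_ℂ = ⟪x, E y⟫_ℂ := fun x y =>
      (ContinuousLinearMap.isSelfAdjoint_iff_isSymmetric.1 hE) x y
    have hck : ∀ y, E ((B ^ k) y) = (B ^ k) (E y) := fun y =>
      DFunLike.congr_fun (hc.pow_right k).eq y
    refine (opNorm_le_of_symmetrizable (B ^ k) (denseRange_of_symmetric _ (pow_symmetric hB k)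
      (pow_injective hinj k)) (E * (B ^ α * X * B ^ β) * E) _ (fun x => ?_) fun x y => ?_).trans_lt
      (((hC E _ hc h1 hε h2)).trans_lt ?_)
    · change E (M (E ((B ^ k) x))) = (B ^ k) (E ((B ^ α) (X ((B ^ β) (E x)))))
      rw [hck, hMX, hck]
    · change ⟪E (M (E x)), y⟫_ℂ = ⟪x, E (M (E y))⟫_ℂ
      rw [hEs, hM, hEs]
    · rw [← mul_div_assoc, div_lt_iff₀ (by positivity)]
      nlinarith

end Cutoff

end PipKLMN

namespace PipKLMN
namespace BddMetric

/-! ### Inclusions, coordinates and duality in the scale. -/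

section Scale

variable {H : Type*} [NormedAddCommGroup H] [InnerProductSpace ℂ H] [CompleteSpace H]
variable (B : BddMetric H)

theorem inner_pow (d : ℕ) (x y : H) : ⟪(B.op ^ d) x, y⟫_ℂ = ⟪x, (B.op ^ d) y⟫_ℂ :=
  pow_symmetric B.pos.isSelfAdjoint d x y

theorem coe_coreEquiv_pow (d : ℕ) (φ : B.core) :
    (((B.coreEquiv ^ d) φ : B.core) : H) = (B.op ^ d) (φ : H) := by
  induction d with
  | zero => rfl
  | succ d ih =>
    rw [pow_succ', pow_succ']
    change B.op (((B.coreEquiv ^ d) φ : B.core) : H) = B.op ((B.op ^ d) (φ : H))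
    rw [ih]

/-- This is `S⁻ⁿ Bᵈ = S⁻⁽ⁿ⁺ᵈ⁾`. It turns comparisons between spaces of the scale into powers of `B`
on `H`. -/
theorem unitary_pow (n : ℤ) (d : ℕ) (η : H) :
    B.unitary n ((B.op ^ d) η) = B.unitary (n + d) η := by
  ext φ
  rw [unitary_apply, unitary_apply, ← inner_pow, add_comm, zpow_add, zpow_natCast]
  congr 1
  exact (B.coe_coreEquiv_pow d ((B.coreEquiv ^ n) φ)).symm

theorem unitary_coord (n : ℤ) (f : B.space n) : B.unitary n (B.coord n f) = f :=
  congrArg Subtype.val ((B.coord n).symm_apply_apply f)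

theorem unitary_mem (n : ℤ) (η : H) : B.unitary n η ∈ B.space n := ⟨η, rfl⟩

theorem coord_eq_iff {n : ℤ} {f : B.space n} {η : H} :
    B.coord n f = η ↔ (f : B.Ambient) = B.unitary n η := by
  rw [← B.unitary_coord n f]
  exact (B.unitary_injective n).eq_iff.symm

/-- The coordinates of a vector with respect to two spaces of the scale. -/
theorem coord_eq_pow {r s : ℤ} {d : ℕ} (h : s = r + d) (f : B.space r) (f' : B.space s)
    (hf : (f : B.Ambient) = f') : B.coord r f = (B.op ^ d) (B.coord s f') := by
  rw [coord_eq_iff, unitary_pow, ← h, unitary_coord, hf]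

theorem space_anti {r s : ℤ} (h : r ≤ s) : B.space s ≤ B.space r := by
  rintro _ ⟨η, rfl⟩
  obtain ⟨d, rfl⟩ := Int.le.dest h
  rw [← unitary_pow]
  exact B.unitary_mem r _

/-- An inclusion against the index order makes `B` onto, and then all spaces coincide. The
hypotheses speak of inclusions, so this degenerate case cannot be excluded. -/
theorem space_le_iff {r s : ℤ} : B.space r ≤ B.space s ↔ s ≤ r ∨ Function.Surjective B.op := by
  constructor
  · intro h
    refine or_iff_not_imp_left.2 fun hlt η => ?_
    obtain ⟨d, rfl⟩ : ∃ d : ℕ, s = r + (d + 1 : ℕ) := ⟨(s - r - 1).toNat, by omega⟩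
    obtain ⟨ζ, hζ⟩ := h (B.unitary_mem r η)
    rw [← unitary_pow] at hζ
    refine ⟨(B.op ^ d) ζ, ?_⟩
    rw [← B.unitary_injective r hζ, pow_succ']
    rfl
  · rintro (h | h)
    · exact B.space_anti h
    · have hsurj : ∀ d : ℕ, Function.Surjective (B.op ^ d : H →L[ℂ] H) := by
        intro d
        induction d with
        | zero => exact fun y => ⟨y, rfl⟩
        | succ d ih =>
          rw [pow_succ']
          exact h.comp ih
      rintro _ ⟨η, rfl⟩
      rcases le_total s r with h' | h'
      · exact B.space_anti h' (B.unitary_mem r η)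
      · obtain ⟨d, rfl⟩ := Int.le.dest h'
        obtain ⟨ζ, rfl⟩ := hsurj d η
        rw [unitary_pow]
        exact B.unitary_mem _ _

/-- Passing to duals reverses inclusions. Writing the negatives as zero sums also covers double
negatives and the index `0` without casts. -/
theorem space_neg_le {r s r' s' : ℤ} (hr : r + r' = 0) (hs : s + s' = 0)
    (h : B.space r ≤ B.space s) : B.space s' ≤ B.space r' := by
  rw [space_le_iff] at h ⊢
  exact h.imp_left fun _ => by omega

theorem space_total (r s : ℤ) : B.space r ≤ B.space s ∨ B.space s ≤ B.space r :=
  (le_total s r).imp (fun h => B.space_anti h) fun h => B.space_anti h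

/-- `Sⁿ : H_n → H` as an isometric isomorphism. -/
def coordIsometry (n : ℤ) : B.space n ≃ₗᵢ[ℂ] H where
  toLinearEquiv := B.coord n
  norm_map' _ := rfl

instance instCompleteSpaceSpace (n : ℤ) : CompleteSpace (B.space n) :=
  (completeSpace_congr (e := (B.coord n).toEquiv)
    (B.coordIsometry n).isometry.isUniformInducing.isUniformEmbedding).2 inferInstance

theorem apply_eq_inner {n : ℤ} (f : B.space n) (φ : B.core) :
    (f : B.Ambient) φ = ⟪(((B.coreEquiv ^ n) φ : B.core) : H), B.coord n f⟫_ℂ := by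
  rw [← unitary_apply, unitary_coord]

/-- Evaluations on `H_∞` are continuous on every `H_n` and separate points, which gives the closed
graphs of inclusions and lets identities extend by density. -/
theorem continuous_apply {n : ℤ} (φ : B.core) :
    Continuous fun f : B.space n => (f : B.Ambient) φ := by
  simp_rw [apply_eq_inner]
  exact continuous_const.inner (B.coordIsometry n).continuous

/-- Inclusions between spaces of the scale are continuous. -/
def inclusionL {r s : ℤ} (h : B.space r ≤ B.space s) : B.space r →L[ℂ] B.space s :=
  ContinuousLinearMap.ofSeqClosedGraph (g := Submodule.inclusion h) fun u x y hu hy => by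
    refine Subtype.ext (LinearMap.ext fun φ => ?_)
    exact tendsto_nhds_unique (((B.continuous_apply φ).tendsto y).comp hy)
      (((B.continuous_apply φ).tendsto x).comp hu)

/-- The form `⟪Sʳ f, Sˢ g⟫` depends on `r + s` only. -/
theorem inner_coord_eq {r s r' s' : ℤ} (h : r + s = r' + s') (f : B.space r) (g : B.space s)
    (f' : B.space r') (g' : B.space s') (hf : (f : B.Ambient) = f') (hg : (g : B.Ambient) = g') :
    ⟪B.coord r f, B.coord s g⟫_ℂ = ⟪B.coord r' f', B.coord s' g'⟫_ℂ := by
  rcases le_total r r' with hr | hr <;> obtain ⟨d, hd⟩ := Int.le.dest hr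
  · rw [B.coord_eq_pow hd.symm f f' hf, B.coord_eq_pow (d := d) (by omega) g' g hg.symm, inner_pow]
  · rw [B.coord_eq_pow hd.symm f' f hf.symm, B.coord_eq_pow (d := d) (by omega) g g' hg, inner_pow]

theorem ext_pip {n : ℤ} {f f' : B.space (-n)} (h : ∀ g, B.pip n f g = B.pip n f' g) : f = f' := by
  refine (B.coord (-n)).injective (ext_inner_right ℂ fun η => ?_)
  simpa [pip] using h ((B.coord n).symm η)

/-- A bounded operator between spaces of the scale has a bounded adjoint between the duals. -/
theorem exists_dual {m n : ℤ} (R : B.space n →L[ℂ] B.space m) :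
    ∃ R' : B.space (-m) →L[ℂ] B.space (-n), ∀ x y, B.pip n (R' y) x = B.pip m y (R x) := by
  let X : H →L[ℂ] H := ((B.coordIsometry m : B.space m →L[ℂ] H) ∘L R) ∘L
    ((B.coordIsometry n).symm : H →L[ℂ] B.space n)
  refine ⟨(((B.coordIsometry (-n)).symm : H →L[ℂ] B.space (-n)) ∘L X.adjoint) ∘L
    (B.coordIsometry (-m) : B.space (-m) →L[ℂ] H), fun x y => ?_⟩
  have h1 : B.coord (-n) ((B.coordIsometry (-n)).symm (X.adjoint (B.coord (-m) y))) =
      X.adjoint (B.coord (-m) y) := (B.coordIsometry (-n)).apply_symm_apply _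
  have h2 : X (B.coord n x) = B.coord m (R x) := by
    change B.coord m (R ((B.coord n).symm (B.coord n x))) = _
    rw [LinearEquiv.symm_apply_apply]
  change ⟪B.coord (-n) ((B.coordIsometry (-n)).symm (X.adjoint (B.coord (-m) y))), _⟫_ℂ = _
  rw [h1, ContinuousLinearMap.adjoint_inner_left, h2]
  rfl

end Scale

end BddMetric
end PipKLMN

namespace PipKLMN
namespace BddMetric

/-! ### Inverses of representatives, and the operators they induce in `H`. -/

section Resolvent

variable {H : Type*} [NormedAddCommGroup H] [InnerProductSpace ℂ H] [CompleteSpace H]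
variable (B : BddMetric H)

/-- `R : H_s → H_r` is the inverse of a representative `(A - z)_{sr}`. -/
structure IsResolvent (A : B.Ambient →ₗ.[ℂ] B.Ambient) (z : ℂ) {r s : ℤ}
    (R : B.space s →L[ℂ] B.space r) : Prop where
  le_domain : B.space r ≤ A.domain
  apply_eq : ∀ y, A ⟨R y, le_domain (R y).2⟩ = y + z • (R y : B.Ambient)
  eq_of_apply_eq : ∀ (x : B.space r) (y : B.space s),
    A ⟨x, le_domain x.2⟩ = y + z • (x : B.Ambient) → R y = x

variable {B}

theorem IsRep.isResolvent {A : B.Ambient →ₗ.[ℂ] B.Ambient} {r s : ℤ}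
    {T : B.space r →L[ℂ] B.space s} (hT : B.IsRep A r s T) {z : ℂ} {h : B.space r ≤ B.space s}
    {R : B.space s →L[ℂ] B.space r} (hl : ∀ x, R (T x - z • Submodule.inclusion h x) = x)
    (hr : ∀ y, T (R y) - z • Submodule.inclusion h (R y) = y) : B.IsResolvent A z R where
  le_domain x hx := (hT ⟨x, hx⟩).1
  apply_eq y := by
    rw [(hT (R y)).2, sub_eq_iff_eq_add.1 (hr y)]
    rfl
  eq_of_apply_eq x y hxy := by
    rw [(hT x).2] at hxy
    rw [← hl x]
    congr 1
    rw [eq_sub_iff_add_eq]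
    exact Subtype.ext hxy.symm

/-- For a symmetric operator, the dual of the inverse of a representative of `A - lam` is the
inverse of a representative of `A - lam`. -/
theorem exists_dual_resolvent {A : B.Ambient →ₗ.[ℂ] B.Ambient} (hA : B.IsSymmetricOp A) {m n : ℤ}
    (hmn : B.space m ≤ B.space n) {T : B.space m →L[ℂ] B.space n} (hT : B.IsRep A m n T) {lam : ℝ}
    {R : B.space n →L[ℂ] B.space m}
    (hl : ∀ x, R (T x - (lam : ℂ) • Submodule.inclusion hmn x) = x)
    (hr : ∀ y, T (R y) - (lam : ℂ) • Submodule.inclusion hmn (R y) = y) :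
    ∃ R' : B.space (-m) →L[ℂ] B.space (-n), B.IsResolvent A lam R' ∧
      ∀ x y, B.pip n (R' y) x = B.pip m y (R x) := by
  obtain ⟨T', hT', hTT'⟩ := hA.2.2 m n T hT
  obtain ⟨R', hR'⟩ := B.exists_dual R
  have hneg : B.space (-n) ≤ B.space (-m) := B.space_neg_le (add_neg_cancel m) (add_neg_cancel n) hmn
  have hι : ∀ x y, B.pip m (Submodule.inclusion hneg y) x =
      B.pip n y (Submodule.inclusion hmn x) := fun x y =>
    B.inner_coord_eq (by ring) _ _ _ _ rfl rfl
  -- Because `lam` is real, `T' - lam` is dual to `T - lam`, so each one-sided inverse identity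
  -- dualizes to the other.
  have key : ∀ x y, B.pip m (T' y - (lam : ℂ) • Submodule.inclusion hneg y) x =
      B.pip n y (T x - (lam : ℂ) • Submodule.inclusion hmn x) := by
    intro x y
    have h1 := hι x y
    have h2 := hTT' x y
    simp only [pip, map_sub, map_smul, inner_sub_left, inner_sub_right, inner_smul_left,
      inner_smul_right, Complex.conj_ofReal] at h1 h2 ⊢
    rw [h1, h2]
  refine ⟨R', hT'.isResolvent (h := hneg) (fun x => B.ext_pip fun g => ?_)
    fun y => B.ext_pip fun g => ?_, hR'⟩
  · rw [hR', key, hr]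
  · rw [key, hR', hl]

/-- `R' y'` already lies in the larger target space and solves `(A - z) x = y` there, where `R`
gives the only solution. -/
theorem IsResolvent.eq_of_le {A : B.Ambient →ₗ.[ℂ] B.Ambient} {z : ℂ} {r s r' s' : ℤ}
    {R : B.space s →L[ℂ] B.space r} {R' : B.space s' →L[ℂ] B.space r'} (hR : B.IsResolvent A z R)
    (hR' : B.IsResolvent A z R') (h : B.space r' ≤ B.space r) (y : B.space s) (y' : B.space s')
    (hy : (y : B.Ambient) = y') : (R y : B.Ambient) = R' y' := by
  have := hR.eq_of_apply_eq (Submodule.inclusion h (R' y')) y ((hR'.apply_eq y').trans (by rw [hy]; rfl))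
  rw [this]
  rfl

theorem IsResolvent.consistent {A : B.Ambient →ₗ.[ℂ] B.Ambient} {z : ℂ} {r s r' s' : ℤ}
    {R : B.space s →L[ℂ] B.space r} {R' : B.space s' →L[ℂ] B.space r'} (hR : B.IsResolvent A z R)
    (hR' : B.IsResolvent A z R') (y : B.space s) (y' : B.space s')
    (hy : (y : B.Ambient) = y') : (R y : B.Ambient) = R' y' := by
  rcases B.space_total r r' with h | h
  · exact (hR'.eq_of_le hR h y' y hy.symm).symm
  · exact hR.eq_of_le hR' h y y' hy

variable (B)

theorem central_mem (x : H) : B.central x ∈ B.space 0 := B.unitary_mem 0 x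

/-- If consistent operators `R : H_q → H_p` and `R' : H_{-p} → H_{-q}` are dual to each other, and
`H_{-p} ⊆ H_q`, then `R` maps `H` into `H` and induces there a bounded self-adjoint operator. -/
theorem exists_symmetric_of_dual {p q p' q' : ℤ} (hp : p + p' = 0) (hq : q + q' = 0)
    (hpq : B.space p ≤ B.space q) (hpq' : B.space p' ≤ B.space q)
    (R : B.space q →L[ℂ] B.space p) (R' : B.space p' →L[ℂ] B.space q')
    (hR : ∀ x y, ⟪B.coord q' (R' y), B.coord q x⟫_ℂ = ⟪B.coord p' y, B.coord p (R x)⟫_ℂ)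
    (hRR' : ∀ (y : B.space q) (y' : B.space p'), (y : B.Ambient) = y' →
      (R y : B.Ambient) = R' y') :
    B.space 0 ≤ B.space q ∧ ∃ M : H →L[ℂ] H, (∀ x y, ⟪M x, y⟫_ℂ = ⟪x, M y⟫_ℂ) ∧
      ∀ (x : H) (h : B.central x ∈ B.space q), (R ⟨_, h⟩ : B.Ambient) = B.central (M x) := by
  -- The witness is `k = |p|`: `H_k` lies in `H` and in the domains of `R` and `R'`, and it contains
  -- the range of `R'`. So `R'` restricts to an endomorphism of `H_k`.
  obtain ⟨k, h0, h1, h2, h3, h4⟩ : ∃ k : ℕ, B.space 0 ≤ B.space q ∧ B.space k ≤ B.space p' ∧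
      B.space k ≤ B.space q ∧ B.space q' ≤ B.space k ∧ B.space k ≤ B.space 0 := by
    rcases le_total 0 p with h | h
    · obtain ⟨k, rfl⟩ := Int.eq_ofNat_of_zero_le h
      have h1 : B.space k ≤ B.space p' := B.space_anti (by omega)
      exact ⟨k, (B.space_anti (by omega)).trans hpq', h1, hpq,
        B.space_neg_le (add_comm p' k ▸ hp) hq hpq', B.space_anti h⟩
    · obtain ⟨k, rfl⟩ := Int.eq_ofNat_of_zero_le (a := p') (by omega)
      exact ⟨k, (B.space_anti h).trans hpq, le_rfl, hpq', B.space_neg_le hp hq hpq,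
        B.space_anti (by omega)⟩
  let L : B.space k →L[ℂ] B.space k := (B.inclusionL h3 ∘L R') ∘L B.inclusionL h1
  let j : B.space k →L[ℂ] H := (B.coordIsometry 0 : B.space 0 →L[ℂ] H) ∘L B.inclusionL h4
  have hj : ∀ x, B.central (j x) = x := fun x => B.unitary_coord 0 (B.inclusionL h4 x)
  have hjd : DenseRange j := by
    have hd := denseRange_of_symmetric _ (B.inner_pow k) (pow_injective B.inj k)
    refine hd.mono ?_
    rintro _ ⟨η, rfl⟩
    refine ⟨(B.coord k).symm η, B.unitary_injective 0 ((hj _).trans ?_)⟩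
    rw [unitary_pow, zero_add]
    rfl
  have hLR : ∀ (x : B.space k) (h : (x : B.Ambient) ∈ B.space q), (R ⟨x, h⟩ : B.Ambient) = L x := fun x h =>
    hRR' _ (B.inclusionL h1 x) rfl
  -- The inner product of `H` on `H_k` equals the pairings of `H_{q'}` with `H_q` and of `H_{p'}`
  -- with `H_p`; consistency replaces `L` by `R'` on one side and by `R` on the other.
  obtain ⟨M, hM, hsymm⟩ := exists_symmetric_extension j hjd L fun x y => by
    have e1 : ⟪j (L x), j y⟫_ℂ = ⟪B.coord q' (R' (B.inclusionL h1 x)),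
        B.coord q (B.inclusionL h2 y)⟫_ℂ :=
      B.inner_coord_eq (by omega) _ _ _ _ rfl rfl
    have e2 : ⟪j x, j (L y)⟫_ℂ = ⟪B.coord p' (B.inclusionL h1 x),
        B.coord p (R (B.inclusionL h2 y))⟫_ℂ :=
      B.inner_coord_eq (by omega) _ _ _ _ rfl (hLR y (h2 y.2)).symm
    rw [e1, e2, hR]
  refine ⟨h0, M, hsymm, fun x h => ?_⟩
  ext φ
  let e : H →L[ℂ] B.space q := B.inclusionL h0 ∘L ((B.coordIsometry 0).symm : H →L[ℂ] B.space 0)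
  refine hjd.induction_on (p := fun x => (R (e x) : B.Ambient) φ = B.central (M x) φ) x
    (isClosed_eq ((B.continuous_apply φ).comp (R ∘L e).continuous) ?_) fun y => ?_
  · exact continuous_const.inner M.continuous
  · rw [hM, hj, ← hLR y (h2 y.2)]
    congr 3
    exact Subtype.ext (hj y)

end Resolvent

end BddMetric
end PipKLMN

namespace PipKLMN
namespace BddMetric

/-! ### The self-adjoint restriction and its compact resolvent. -/

section Main

variable {H : Type*} [NormedAddCommGroup H] [InnerProductSpace ℂ H] [CompleteSpace H]
variable (B : BddMetric H)

/-- `M` is induced in `H` by the operator `R` of the scale. -/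
def Induces {r s : ℤ} (R : B.space s →L[ℂ] B.space r) (M : H →L[ℂ] H) : Prop :=
  ∀ (x : H) (h : B.central x ∈ B.space s), (R ⟨_, h⟩ : B.Ambient) = B.central (M x)

variable {B}

/-- Consistent dual operators induce one and the same bounded self-adjoint operator in `H`. -/
theorem exists_symmetric_of_dual_pair {m n : ℤ} (hmn : B.space m ≤ B.space n)
    (R : B.space n →L[ℂ] B.space m) (R' : B.space (-m) →L[ℂ] B.space (-n))
    (hR : ∀ x y, B.pip n (R' y) x = B.pip m y (R x))
    (hRR' : ∀ (y : B.space n) (y' : B.space (-m)), (y : B.Ambient) = y' →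
      (R y : B.Ambient) = R' y') :
    ∃ M : H →L[ℂ] H, (∀ x y, ⟪M x, y⟫_ℂ = ⟪x, M y⟫_ℂ) ∧ B.Induces R M ∧ B.Induces R' M := by
  -- `R` and `R'` play symmetric roles; the one with the larger domain takes the place of `R` in
  -- `exists_symmetric_of_dual`.
  rcases B.space_total (-m) n with h | h
  · obtain ⟨h0, M, hM, hRM⟩ := B.exists_symmetric_of_dual (add_neg_cancel m) (add_neg_cancel n)
      hmn h R R' hR hRR'
    exact ⟨M, hM, hRM, fun x hx => (hRR' ⟨_, h hx⟩ ⟨_, hx⟩ rfl).symm.trans (hRM x _)⟩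
  · obtain ⟨h0, M, hM, hRM⟩ := B.exists_symmetric_of_dual (neg_add_cancel n) (neg_add_cancel m)
      (B.space_neg_le (add_neg_cancel m) (add_neg_cancel n) hmn) h R' R
      (fun x y => by
        rw [← inner_conj_symm, ← inner_conj_symm (B.coord n y)]
        exact congrArg _ (hR y x).symm)
      fun y y' hy => (hRR' y' y hy.symm).symm
    exact ⟨M, hM, fun x hx => (hRR' ⟨_, hx⟩ ⟨_, h hx⟩ rfl).trans (hRM x _), hRM⟩

/-- With `X = Sʳ R S⁻ˢ`, `k = |s|`, `α = r - k` and `β = k - s`, one has `M Bᵏ = Bᵏ Bᵅ X Bᵝ`. Here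
`α + β = r - s` is positive, as the cutoff argument needs. -/
theorem Induces.isCompactOperator {r s : ℤ} {R : B.space s →L[ℂ] B.space r} {M : H →L[ℂ] H}
    (hRM : B.Induces R M) (hM : ∀ x y, ⟪M x, y⟫_ℂ = ⟪x, M y⟫_ℂ) (hr : |s| ≤ r) (hsr : s < r) {d : ℕ}
    (hd : 1 ≤ d) (hcpt : IsCompactOperator (B.op ^ d : H →L[ℂ] H)) : IsCompactOperator M := by
  obtain ⟨k, hk⟩ := Int.eq_ofNat_of_zero_le (abs_nonneg s)
  obtain ⟨α, hα⟩ := Int.le.dest (hk ▸ hr)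
  obtain ⟨β, hβ⟩ := Int.le.dest (hk ▸ le_abs_self s)
  let X : H →L[ℂ] H := ((B.coordIsometry r : B.space r →L[ℂ] H) ∘L R) ∘L
    ((B.coordIsometry s).symm : H →L[ℂ] B.space s)
  refine isCompactOperator_of_intertwining B.pos.isSelfAdjoint B.inj hd hcpt M X hM (k := k)
    (α := α) (β := β) (by omega) fun y => B.unitary_injective 0 ?_
  have e : B.central ((B.op ^ k) y) = B.unitary s ((B.op ^ β) y) := by
    rw [central, unitary_pow, unitary_pow, hβ, zero_add]
  have h1 := hRM _ (e ▸ B.unitary_mem s _)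
  have h2 : B.unitary 0 ((B.op ^ k) ((B.op ^ α) (X ((B.op ^ β) y)))) =
      B.unitary r (X ((B.op ^ β) y)) := by
    rw [unitary_pow, unitary_pow, zero_add, hα]
  refine h1.symm.trans (Eq.trans ?_ h2.symm)
  refine Eq.trans ?_ (B.unitary_coord r (R ((B.coord s).symm ((B.op ^ β) y)))).symm
  exact congrArg (fun f => (R f : B.Ambient)) (Subtype.ext e)

/-- If an embedding `H_m → H_n` is compact, then either `H` is finite-dimensional, or `m > n` and
`S⁻¹` has a compact power. -/
theorem finiteDimensional_or_isCompactOperator_pow {m n : ℤ} (hmn : B.space m ≤ B.space n)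
    (h : IsCompactOperator (Submodule.inclusion hmn)) :
    FiniteDimensional ℂ H ∨
      n < m ∧ ∃ d : ℕ, 1 ≤ d ∧ IsCompactOperator (B.op ^ d : H →L[ℂ] H) := by
  rcases le_or_gt m n with hlt | hlt
  · left
    -- For `m ≤ n` the embedding can be followed by the inclusion back into `H_m`, so the identity
    -- of `H_m` is compact.
    have hid : IsCompactOperator (id : B.space m → B.space m) :=
      h.clm_comp (B.inclusionL (B.space_anti hlt))
    have := FiniteDimensional.of_isCompactOperator_id (𝕜 := ℂ) hid
    exact (B.coord m).finiteDimensional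
  · right
    obtain ⟨d, hd⟩ := Int.le.dest hlt.le
    refine ⟨hlt, d, by omega, ?_⟩
    have h1 := (h.comp_clm ((B.coordIsometry m).symm : H →L[ℂ] B.space m)).clm_comp
      (B.coordIsometry n : B.space n →L[ℂ] H)
    refine (congrArg IsCompactOperator (funext fun η => ?_)).mp h1
    have h2 := B.coord_eq_pow hd.symm (Submodule.inclusion hmn ((B.coord m).symm η))
      ((B.coord m).symm η) rfl
    rw [LinearEquiv.apply_symm_apply] at h2
    exact h2

theorem IsResolvent.injective {A : B.Ambient →ₗ.[ℂ] B.Ambient} {z : ℂ} {r s : ℤ}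
    {R : B.space s →L[ℂ] B.space r} (hR : B.IsResolvent A z R) : Function.Injective R := by
  intro y y' h
  have h1 := hR.apply_eq y
  have h2 := hR.apply_eq y'
  simp only [h] at h1
  exact Subtype.ext (add_right_cancel (h1.symm.trans h2))

/-- If the operator induced in `H` by the inverse of a representative of `A - lam` is self-adjoint,
then it is the resolvent of a unique self-adjoint restriction of `A`. -/
theorem exists_selfAdjoint_restriction {A F : B.Ambient →ₗ.[ℂ] B.Ambient} {lam : ℝ} {r s : ℤ}
    {R : B.space s →L[ℂ] B.space r} (hR : B.IsResolvent A lam R) (hs : B.space 0 ≤ B.space s)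
    {M : H →L[ℂ] H} (hM : ∀ x y, ⟪M x, y⟫_ℂ = ⟪x, M y⟫_ℂ) (hRM : B.Induces R M) (hFA : F ≤ A)
    (hrF : B.space r ≤ F.domain) (hFr : ∀ x ∈ F.domain, x ∈ B.space 0 → x ∈ B.space r) :
    ∃ a : H →ₗ.[ℂ] H, (IsSelfAdjoint a ∧ B.IsRestriction a F) ∧
      (∀ b : H →ₗ.[ℂ] H, IsSelfAdjoint b → B.IsRestriction b F → b = a) ∧
      (a.domain : Set H) = B.domainInH F ∧ (∀ x, x ∈ a.domain ↔ ∃ y, M y = x) ∧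
      ∀ (x : a.domain) (y : H), M y = x → a x = y + (lam : ℂ) • (x : H) := by
  have hmem : ∀ x, B.central x ∈ B.space s := fun x => hs (B.central_mem x)
  have hinj : Function.Injective M := by
    intro x y h
    have h1 : R ⟨_, hmem x⟩ = R ⟨_, hmem y⟩ := Subtype.ext (by rw [hRM, hRM, h])
    exact B.unitary_injective 0 (congrArg Subtype.val (hR.injective h1))
  obtain ⟨a, ha, hdom, hval⟩ := exists_selfAdjoint_of_resolvent M hM hinj lam
  have hres : B.IsRestriction a F := by
    intro ξ
    obtain ⟨y, hy⟩ := (hdom _).1 ξ.2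
    have e : (R ⟨_, hmem y⟩ : B.Ambient) = B.central ξ := by rw [hRM, hy]
    have h1 : B.central ξ ∈ B.space r := e ▸ (R ⟨_, hmem y⟩).2
    refine ⟨hrF h1, ?_⟩
    have h2 := hR.apply_eq ⟨_, hmem y⟩
    simp only [e] at h2
    rw [hval ξ y hy, map_add, map_smul, ← h2]
    exact hFA.2 rfl
  -- Maximality: if `F ξ = η` is in `H`, then `ξ` is in `H_r` by `hFr`, and solving `(A - lam) ξ = η
  -- - lam ξ` there gives `ξ = M (η - lam ξ)`. Uniqueness follows, since every restriction of `F` in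
  -- `H` then has its domain inside that of `a`.
  have hsub : ∀ ξ (h : B.central ξ ∈ F.domain), F ⟨_, h⟩ ∈ B.space 0 → ξ ∈ a.domain := by
    rintro ξ h ⟨η, hη⟩
    have hr : B.central ξ ∈ B.space r := hFr _ h (B.central_mem ξ)
    have h1 := hR.eq_of_apply_eq ⟨_, hr⟩ ⟨_, hmem (η - (lam : ℂ) • ξ)⟩ (by
      have h2 : A ⟨B.central ξ, hR.le_domain hr⟩ = F ⟨_, h⟩ := (hFA.2 rfl).symm
      change A ⟨B.central ξ, _⟩ = _
      rw [h2, ← hη]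
      change B.central η = B.central (η - (lam : ℂ) • ξ) + (lam : ℂ) • B.central ξ
      rw [map_sub, map_smul, sub_add_cancel])
    refine (hdom ξ).2 ⟨η - (lam : ℂ) • ξ, B.unitary_injective 0 ?_⟩
    exact (hRM _ _).symm.trans (congrArg Subtype.val h1)
  refine ⟨a, ⟨ha, hres⟩, fun b hb hbF => ?_, Set.ext fun ξ => ⟨fun h => ?_, fun h => ?_⟩, hdom, hval⟩
  · refine eq_of_le_of_isSelfAdjoint ha hb ⟨fun ξ hξ => ?_, fun x y hxy => ?_⟩
    · obtain ⟨h, h'⟩ := hbF ⟨ξ, hξ⟩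
      exact hsub ξ h (h' ▸ B.central_mem _)
    · obtain ⟨h1, h1'⟩ := hbF x
      obtain ⟨h2, h2'⟩ := hres y
      refine B.unitary_injective 0 (h1'.symm.trans (Eq.trans ?_ h2'))
      congr 2
      rw [hxy]
  · obtain ⟨h1, h2⟩ := hres ⟨ξ, h⟩
    exact ⟨h1, h2 ▸ B.central_mem _⟩
  · obtain ⟨h1, h2⟩ := h
    exact hsub ξ h1 h2

end Main

end BddMetric
end PipKLMN

end

theorem mainTheorem7 {H : Type*} [NormedAddCommGroup H] [InnerProductSpace ℂ H] [CompleteSpace H]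
    (G : H →ₗ.[ℂ] H) (hG : PipKLMN.IsMetricOperator G)
    (B : PipKLMN.BddMetric H) (hB : PipKLMN.IsScaleGenerator G B)
    (A : B.Ambient →ₗ.[ℂ] B.Ambient) (hA : B.IsSymmetricOp A)
    (m n : ℤ) (hmn : B.space m ≤ B.space n)
    (T : B.space m →L[ℂ] B.space n) (hT : B.IsRep A m n T)
    (lam : ℝ) (hlam : B.IsBddInvertible T (lam : ℂ) hmn)
    (F : B.Ambient →ₗ.[ℂ] B.Ambient)
    (hF : (B.space 0 ≤ B.space n ∧ F = A.domRestrict (B.space m)) ∨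
      (B.space n ≤ B.space 0 ∧ F = A)) :
    ∃ a : H →ₗ.[ℂ] H,
      (IsSelfAdjoint a ∧ B.IsRestriction a F) ∧
      (∀ b : H →ₗ.[ℂ] H, IsSelfAdjoint b → B.IsRestriction b F → b = a) ∧
      Dense (a.domain : Set H) ∧
      (a.domain : Set H) = B.domainInH F ∧
      (lam : ℂ) ∈ PipKLMN.resolventSet a ∧
      (IsCompactOperator (Submodule.inclusion hmn) →
        PipKLMN.spectrumSet a = PipKLMN.pointSpectrum a ∧
        (∀ z ∈ PipKLMN.pointSpectrum a, FiniteDimensional ℂ (PipKLMN.eigenspace a z)) ∧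
        PipKLMN.contSpectrum a = ∅) := by
  
  obtain ⟨R, hl, hr⟩ := hlam
  have hRes := hT.isResolvent (h := hmn) hl hr
  obtain ⟨R', hRes', hdual⟩ := PipKLMN.BddMetric.exists_dual_resolvent hA hmn hT hl hr
  obtain ⟨M, hM, hRM, hRM'⟩ := PipKLMN.BddMetric.exists_symmetric_of_dual_pair hmn R R' hdual
    (hRes.consistent hRes')
  have hcompact : IsCompactOperator (Submodule.inclusion hmn) → IsCompactOperator M := by
    intro hc
    rcases PipKLMN.BddMetric.finiteDimensional_or_isCompactOperator_pow hmn hc with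
      hfin | ⟨hlt, d, hd, hcpt⟩
    · exact (isCompactOperator_id_iff_finiteDimensional.2 hfin).comp_clm M
    · rcases le_total (-n) m with h | h
      · exact hRM.isCompactOperator hM (abs_le.2 ⟨by omega, hlt.le⟩) hlt hd hcpt
      · exact hRM'.isCompactOperator hM (abs_le.2 ⟨by omega, by omega⟩) (by omega) hd hcpt
  have hmain : ∃ a : H →ₗ.[ℂ] H, (IsSelfAdjoint a ∧ B.IsRestriction a F) ∧
      (∀ b : H →ₗ.[ℂ] H, IsSelfAdjoint b → B.IsRestriction b F → b = a) ∧
      (a.domain : Set H) = B.domainInH F ∧ (∀ x, x ∈ a.domain ↔ ∃ y, M y = x) ∧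
      ∀ (x : a.domain) (y : H), M y = x → a x = y + (lam : ℂ) • (x : H) := by
    -- For `F = A_{nm}` the inverse `R` is defined on all of `H`. For `F = A` it is `R'` that is,
    -- and its range `H_{-n}` contains `H`, so no vector of `H` in the domain of `A` is lost.
    rcases hF with ⟨h0, rfl⟩ | ⟨h0, rfl⟩
    · exact PipKLMN.BddMetric.exists_selfAdjoint_restriction hRes h0 hM hRM
        LinearPMap.domRestrict_le (fun x hx => ⟨hx, hRes.le_domain hx⟩) fun x hx _ => hx.1
    · have h1 : B.space 0 ≤ B.space (-n) := B.space_neg_le (add_neg_cancel n) (add_zero 0) h0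
      have h2 : B.space 0 ≤ B.space (-m) :=
        B.space_neg_le (add_neg_cancel m) (add_zero 0) (hmn.trans h0)
      exact PipKLMN.BddMetric.exists_selfAdjoint_restriction hRes' h2 hM hRM' le_rfl
        hRes'.le_domain fun x _ hx => h1 hx
  obtain ⟨a, ha, hunique, hdomain, hdom, hval⟩ := hmain
  exact ⟨a, ha, hunique, ha.1.dense_domain, hdomain, PipKLMN.mem_resolventSet_of_range hdom hval,
    fun hc => PipKLMN.spectrum_of_isCompactOperator hdom hval (hcompact hc)⟩
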